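/- Let $p$ be a prime number, let $d \ge 0$ be an integer, and let $P \subset \mathbb{R}^d$ be a lattice polytope (a convex polytope all of whose vertices lie in $\mathbb{Z}^d$) of dimension $d$ whose normalized volume $d!\cdot\mathrm{vol}(P)$ equals $p$. Suppose that $P$ is not an empty simplex, i.e. $P$ is not a simplex whose only lattice points are its vertices. Then $P$ is spanning: the affine sublattice of $\mathbb{Z}^d$ generated by $P \cap \mathbb{Z}^d$ (the set of all integer affine combinations of points of $P \cap \mathbb{Z}^d$) has index $1$ in $\mathbb{Z}^d$. -/

import Mathlib

open MeasureTheory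
open scoped Nat

namespace LatticePolytope

/-- The inclusion `ℤ^d → ℝ^d`. -/
def latticeEmb (d : ℕ) (z : Fin d → ℤ) : Fin d → ℝ := fun i => (z i : ℝ)

/-- A convex polytope in `ℝ^d`: the convex hull of finitely many points. -/
def IsConvexPolytope {d : ℕ} (P : Set (Fin d → ℝ)) : Prop :=
  ∃ S : Set (Fin d → ℝ), S.Finite ∧ P = convexHull ℝ S

/-- A lattice polytope: a convex polytope all of whose vertices (extreme points) lie in `ℤ^d`. -/
def IsLatticePolytope {d : ℕ} (P : Set (Fin d → ℝ)) : Prop :=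
  IsConvexPolytope P ∧ P.extremePoints ℝ ⊆ Set.range (latticeEmb d)

/-- The dimension of `P`, i.e. the dimension of its affine hull. -/
noncomputable def dim {d : ℕ} (P : Set (Fin d → ℝ)) : ℕ :=
  Module.finrank ℝ (vectorSpan ℝ P)

/-- The normalized volume `d! · vol(P)` of `P ⊆ ℝ^d`. -/
noncomputable def normalizedVolume {d : ℕ} (P : Set (Fin d → ℝ)) : ℝ :=
  (d ! : ℝ) * (volume P).toReal

/-- The set `P ∩ ℤ^d`, as a set of integer vectors. -/
def latticePoints {d : ℕ} (P : Set (Fin d → ℝ)) : Set (Fin d → ℤ) :=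
  {z | latticeEmb d z ∈ P}

/-- The affine sublattice of `ℤ^d` generated by `P ∩ ℤ^d`: all integer affine combinations of
lattice points of `P`. -/
def affineLattice {d : ℕ} (P : Set (Fin d → ℝ)) : AffineSubspace ℤ (Fin d → ℤ) :=
  affineSpan ℤ (latticePoints P)

/-- The index of `P`: the index in `ℤ^d` of the affine sublattice generated by `P ∩ ℤ^d`, that is,
of the subgroup of which it is a translate. (It is `0` if that index is infinite.) -/
noncomputable def index {d : ℕ} (P : Set (Fin d → ℝ)) : ℕ :=
  (affineLattice P).direction.toAddSubgroup.index

/-- `P` is spanning if its index is `1`. -/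
def IsSpanning {d : ℕ} (P : Set (Fin d → ℝ)) : Prop :=
  index P = 1

/-- An empty simplex: a lattice polytope that is a simplex (the convex hull of affinely independent
points, its vertices) and contains no lattice points other than its vertices. -/
def IsEmptySimplex {d : ℕ} (P : Set (Fin d → ℝ)) : Prop :=
  IsLatticePolytope P ∧
    ∃ (n : ℕ) (s : Affine.Simplex ℝ (Fin d → ℝ) n),
      P = convexHull ℝ (Set.range s.points) ∧
      ∀ z ∈ latticePoints P, latticeEmb d z ∈ Set.range s.points

end LatticePolytope

namespace LatticePolytope

/-- The corner simplex `{x ≥ 0, ∑ xᵢ ≤ r}`. -/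
def corner (d : ℕ) (r : ℝ) : Set (Fin d → ℝ) := {x | (∀ i, 0 ≤ x i) ∧ ∑ i, x i ≤ r}

theorem volume_corner (d : ℕ) : ∀ r : ℝ, 0 ≤ r →
    volume (corner d r) = ENNReal.ofReal (r ^ d / d !) := by
  induction d with
  | zero =>
    intro r hr
    have : corner 0 r = Set.univ := by ext x; simp [corner, hr]
    rw [this]
    simp [volume_pi]
  | succ d ih =>
    intro r hr
    have hmp := volume_preserving_piFinSuccAbove (fun _ : Fin (d + 1) => ℝ) 0
    have hpre : corner (d + 1) r = MeasurableEquiv.piFinSuccAbove (fun _ : Fin (d + 1) => ℝ) 0 ⁻¹'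
        {q : ℝ × (Fin d → ℝ) | 0 ≤ q.1 ∧ q.2 ∈ corner d (r - q.1)} := by
      ext x
      simp only [corner, Set.mem_ofPred_eq, Set.mem_preimage, Fin.forall_fin_succ, Fin.sum_univ_succ,
        MeasurableEquiv.piFinSuccAbove_apply, Fin.insertNthEquiv_zero, Fin.consEquiv_symm_apply,
        Fin.tail, le_sub_iff_add_le']
      tauto
    have hcl : IsClosed {q : ℝ × (Fin d → ℝ) | 0 ≤ q.1 ∧ q.2 ∈ corner d (r - q.1)} := by
      refine IsClosed.inter (s₁ := {q : ℝ × (Fin d → ℝ) | 0 ≤ q.1})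
        (isClosed_le continuous_const continuous_fst) ?_
      refine IsClosed.inter (s₁ := {q : ℝ × (Fin d → ℝ) | ∀ i, 0 ≤ q.2 i}) ?_ ?_
      · simp only [Set.ofPred_forall]
        exact isClosed_iInter fun i => isClosed_le continuous_const (by fun_prop)
      · exact isClosed_le (f := fun q : ℝ × (Fin d → ℝ) => ∑ i, q.2 i) (g := fun q => r - q.1)
          (by fun_prop) (by fun_prop)
    rw [hpre, hmp.measure_preimage hcl.measurableSet.nullMeasurableSet,
      Measure.volume_eq_prod, Measure.prod_apply hcl.measurableSet]
    have hfib : ∀ t : ℝ, volume (Prod.mk t ⁻¹'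
        {q : ℝ × (Fin d → ℝ) | 0 ≤ q.1 ∧ q.2 ∈ corner d (r - q.1)}) =
        (Set.Icc 0 r).indicator (fun t => ENNReal.ofReal ((r - t) ^ d / d !)) t := by
      intro t
      by_cases ht : t ∈ Set.Icc 0 r
      · rw [Set.indicator_of_mem ht, ← ih (r - t) (by linarith [ht.2])]
        congr 1
        ext y
        simp [ht.1]
      · rw [Set.indicator_of_notMem ht]
        convert measure_empty (μ := volume)
        ext y
        simp only [Set.mem_preimage, Set.mem_ofPred_eq, Set.mem_empty_iff_false, iff_false]
        rintro ⟨h0, hy, hs⟩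
        exact ht ⟨h0, by linarith [Finset.sum_nonneg fun i (_ : i ∈ Finset.univ) => hy i]⟩
    simp only [hfib]
    rw [lintegral_indicator measurableSet_Icc, ← ofReal_integral_eq_lintegral_ofReal]
    · congr 1
      rw [integral_Icc_eq_integral_Ioc, ← intervalIntegral.integral_of_le hr,
        intervalIntegral.integral_div,
        intervalIntegral.integral_comp_sub_left (fun t => t ^ d) r, integral_pow]
      simp only [sub_self, sub_zero, Nat.factorial_succ, Nat.cast_mul, Nat.cast_succ]
      rw [zero_pow (by omega), sub_zero, div_div]
    · exact (Continuous.integrableOn_Icc (by fun_prop))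
    · filter_upwards [ae_restrict_mem measurableSet_Icc] with t ht
      have : 0 ≤ r - t := by linarith [ht.2]
      positivity

theorem convex_corner (d : ℕ) (r : ℝ) : Convex ℝ (corner d r) := by
  rintro x ⟨hx, hxs⟩ y ⟨hy, hys⟩ a b ha hb hab
  refine ⟨fun i => ?_, ?_⟩
  · have := hx i
    have := hy i
    simp only [Pi.add_apply, Pi.smul_apply, smul_eq_mul]
    positivity
  · simp only [Pi.add_apply, Pi.smul_apply, smul_eq_mul, Finset.sum_add_distrib, ← Finset.mul_sum]
    calc a * ∑ i, x i + b * ∑ i, y i ≤ a * r + b * r := by gcongr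
      _ = r := by rw [← add_mul, hab, one_mul]

theorem convexHull_range_eq_image_corner {d : ℕ} (v : Fin (d + 1) → Fin d → ℝ) :
    convexHull ℝ (Set.range v) = (fun y => v 0 + y) ''
      ((Matrix.toLin' (Matrix.of fun i j => v (Fin.succ j) i - v 0 i)) '' corner d 1) := by
  have key : ∀ x : Fin d → ℝ,
      v 0 + Matrix.toLin' (Matrix.of fun i j => v (Fin.succ j) i - v 0 i) x =
        (1 - ∑ j, x j) • v 0 + ∑ j, x j • v (Fin.succ j) := by
    intro x
    ext i
    simp only [Matrix.toLin'_apply, Pi.add_apply, Matrix.mulVec, dotProduct, Matrix.of_apply,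
      Pi.smul_apply, Finset.sum_apply, smul_eq_mul, sub_mul, Finset.sum_sub_distrib, one_mul,
      Finset.sum_mul, mul_comm (x _)]
    ring
  apply subset_antisymm
  · refine convexHull_min ?_ (((convex_corner d 1).linear_image _).translate _)
    rw [Set.image_image]
    rintro _ ⟨i, rfl⟩
    refine Fin.cases ?_ (fun j => ?_) i
    · exact ⟨0, ⟨fun _ => le_rfl, by simp⟩, by simp⟩
    · refine ⟨Pi.single j 1, ⟨fun i => ?_, by simp⟩, ?_⟩
      · by_cases h : i = j
        · subst h; simp
        · simp [h]
      · simp only [key]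
        simp [Pi.single_apply, ite_smul]
  · rw [Set.image_image]
    rintro _ ⟨x, ⟨hx0, hx1⟩, rfl⟩
    simp only [key]
    have := (convex_convexHull ℝ (Set.range v)).sum_mem (t := Finset.univ)
      (w := Fin.cons (1 - ∑ j, x j) x) (z := v)
      (by intro i _; refine Fin.cases ?_ ?_ i <;> simp [hx0, hx1])
      (by simp [Fin.sum_univ_succ]) (fun i _ => subset_convexHull ℝ _ ⟨i, rfl⟩)
    simpa [Fin.sum_univ_succ] using this

theorem normalizedVolume_convexHull_range {d : ℕ} (v : Fin (d + 1) → Fin d → ℝ) :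
    normalizedVolume (convexHull ℝ (Set.range v)) =
      |(Matrix.of fun i j => v (Fin.succ j) i - v 0 i).det| := by
  rw [normalizedVolume, convexHull_range_eq_image_corner, Set.image_add_left,
    measure_preimage_add, Measure.addHaar_image_linearMap, volume_corner d 1 zero_le_one,
    LinearMap.det_toLin', ENNReal.toReal_mul, ENNReal.toReal_ofReal (abs_nonneg _),
    ENNReal.toReal_ofReal (by positivity), one_pow, mul_left_comm, mul_one_div_cancel
    (Nat.cast_ne_zero.2 (Nat.factorial_ne_zero d)), mul_one]

/-- The index of a subgroup of `ℤ^d` divides the determinant of any `d` of its elements. -/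
theorem index_dvd_natAbs_det {d : ℕ} (L : AddSubgroup (Fin d → ℤ)) (M : Matrix (Fin d) (Fin d) ℤ)
    (hM : ∀ j, M.col j ∈ L) : L.index ∣ M.det.natAbs := by
  by_cases h0 : M.det = 0
  · simp [h0]
  have hinj : Function.Injective (Matrix.toLin' M) :=
    Matrix.mulVec_injective_of_det_ne_zero h0
  have hcard := Submodule.natAbs_det_equiv (LinearMap.range (Matrix.toLin' M))
    (LinearEquiv.ofInjective _ hinj)
  have hcomp : (LinearMap.range (Matrix.toLin' M)).subtype ∘ₗ
      ((LinearEquiv.ofInjective _ hinj : _ ≃ₗ[ℤ] LinearMap.range (Matrix.toLin' M)) :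
        (Fin d → ℤ) →+ LinearMap.range (Matrix.toLin' M)).toIntLinearMap = Matrix.toLin' M := by
    ext; rfl
  rw [hcomp, LinearMap.det_toLin'] at hcard
  have hle : (LinearMap.range (Matrix.toLin' M)).toAddSubgroup ≤ L := by
    rintro _ ⟨x, rfl⟩
    rw [Matrix.toLin'_apply, Matrix.mulVec_eq_sum]
    refine sum_mem fun j _ => ?_
    simpa using L.zsmul_mem (show M.transpose j ∈ L from hM j) (x j)
  rw [hcard]
  exact AddSubgroup.index_dvd_of_le hle

theorem exists_normalizedVolume_convexHull_range_eq {d : ℕ} (L : AddSubgroup (Fin d → ℤ))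
    (v : Fin (d + 1) → Fin d → ℤ) (hv : ∀ i, v i - v 0 ∈ L) :
    ∃ n : ℕ, normalizedVolume (convexHull ℝ (Set.range fun i => latticeEmb d (v i))) =
      L.index * n := by
  obtain ⟨n, hn⟩ := index_dvd_natAbs_det L (Matrix.of fun i j => v (Fin.succ j) i - v 0 i)
    (fun j => hv _)
  refine ⟨n, ?_⟩
  rw [normalizedVolume_convexHull_range, ← Nat.cast_mul, ← hn, Nat.cast_natAbs, Int.cast_abs,
    Int.cast_det]
  congr 2
  ext i j
  simp [latticeEmb]

section RegularTriangulation

variable {E : Type*} [AddCommGroup E] [Module ℝ E]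

theorem affineMap_apply_sum_smul (h : E →ᵃ[ℝ] ℝ) (σ : Finset E) (w : E → ℝ)
    (hw : ∑ e ∈ σ, w e = 1) : h (∑ e ∈ σ, w e • e) = ∑ e ∈ σ, w e * h e := by
  have hd : ∀ y, h y = h.linear y + h 0 := fun y => by
    conv_lhs => rw [h.decomp]
    rfl
  rw [hd, Finset.sum_congr rfl fun e _ => congrArg (w e * ·) (hd e)]
  simp only [map_sum, map_smul, smul_eq_mul, mul_add, Finset.sum_add_distrib]
  rw [← Finset.sum_mul, hw, one_mul]

theorem exists_weights_of_mem_affineSpan {σ : Finset E} {a : E}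
    (ha : a ∈ affineSpan ℝ (σ : Set E)) :
    ∃ g : E → ℝ, (∀ e ∉ σ, g e = 0) ∧ ∑ e ∈ σ, g e = 1 ∧ ∑ e ∈ σ, g e • e = a := by
  classical
  have ha' : a ∈ affineSpan ℝ (Set.range ((↑) : σ → E)) := by simpa using ha
  obtain ⟨g, hg, rfl⟩ := eq_affineCombination_of_mem_affineSpan_of_fintype ha'
  refine ⟨fun e => if h : e ∈ σ then g ⟨e, h⟩ else 0, fun e he => by simp [he], ?_, ?_⟩
  · rw [← Finset.sum_coe_sort]
    simpa using hg
  · rw [← Finset.sum_coe_sort, Finset.affineCombination_eq_linear_combination _ _ _ hg]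
    simp

/-- The simplices of `S` that are faces of the lower convex hull of the points of `S` lifted to
the heights `ω`. -/
def IsRegularCell (ω : E → ℝ) (S σ : Finset E) : Prop :=
  ∃ h : E →ᵃ[ℝ] ℝ, (∀ a ∈ σ, h a = ω a) ∧ ∀ a ∈ S, a ∉ σ → h a < ω a

theorem IsRegularCell.mem_convexHull_inter [DecidableEq E] {ω : E → ℝ} {S σ τ : Finset E}
    (hσ : IsRegularCell ω S σ) (hτ : IsRegularCell ω S τ) (hσS : σ ⊆ S) (hτS : τ ⊆ S) {x : E}
    (hxσ : x ∈ convexHull ℝ (σ : Set E)) (hxτ : x ∈ convexHull ℝ (τ : Set E)) :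
    x ∈ convexHull ℝ ((σ ∩ τ : Finset E) : Set E) := by
  obtain ⟨h, hh, hlt⟩ := hσ
  obtain ⟨k, hk, klt⟩ := hτ
  have hle : ∀ a ∈ S, h a ≤ ω a := fun a ha => by
    by_cases h' : a ∈ σ
    exacts [(hh a h').le, (hlt a ha h').le]
  have kle : ∀ a ∈ S, k a ≤ ω a := fun a ha => by
    by_cases h' : a ∈ τ
    exacts [(hk a h').le, (klt a ha h').le]
  rw [Finset.mem_convexHull'] at hxσ hxτ ⊢
  obtain ⟨w, hw0, hw1, hwx⟩ := hxσ
  obtain ⟨u, hu0, hu1, hux⟩ := hxτ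
  have e1 : h x = ∑ e ∈ σ, w e * ω e := by
    rw [← hwx, affineMap_apply_sum_smul _ _ _ hw1]
    exact Finset.sum_congr rfl fun e he => by rw [hh e he]
  have e2 : k x = ∑ e ∈ τ, u e * ω e := by
    rw [← hux, affineMap_apply_sum_smul _ _ _ hu1]
    exact Finset.sum_congr rfl fun e he => by rw [hk e he]
  have e3 : h x = ∑ e ∈ τ, u e * h e := by rw [← hux, affineMap_apply_sum_smul _ _ _ hu1]
  have e4 : k x = ∑ e ∈ σ, w e * k e := by rw [← hwx, affineMap_apply_sum_smul _ _ _ hw1]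
  have l1 : k x ≤ h x := by
    rw [e4, e1]
    exact Finset.sum_le_sum fun e he => mul_le_mul_of_nonneg_left (kle e (hσS he)) (hw0 e he)
  have hnn : ∀ e ∈ τ, 0 ≤ u e * (ω e - h e) := fun e he =>
    mul_nonneg (hu0 e he) (sub_nonneg.2 (hle e (hτS he)))
  have hz : ∑ e ∈ τ, u e * (ω e - h e) = 0 := by
    refine le_antisymm ?_ (Finset.sum_nonneg hnn)
    simp only [mul_sub, Finset.sum_sub_distrib, ← e2, ← e3]
    linarith
  have hu : ∀ e ∈ τ, e ∉ σ ∩ τ → u e = 0 := fun e he hn => by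
    have hz' := (Finset.sum_eq_zero_iff_of_nonneg hnn).1 hz e he
    have := hlt e (hτS he) (fun h' => hn (Finset.mem_inter.2 ⟨h', he⟩))
    exact (mul_eq_zero.1 hz').resolve_right (by linarith)
  refine ⟨u, fun e he => hu0 e (Finset.mem_inter.1 he).2, ?_, ?_⟩
  · rw [Finset.sum_subset Finset.inter_subset_right hu, hu1]
  · rw [Finset.sum_subset Finset.inter_subset_right fun e he hn => by rw [hu e he hn, zero_smul],
      hux]

/-- Generic heights: an affine function that agrees with `ω` on an affinely spanning subset of `S`
agrees with `ω` at no other point of `S`. -/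
theorem exists_generic_heights (S : Finset E) : ∃ ω : E → ℝ,
    ∀ τ ⊆ S, affineSpan ℝ (τ : Set E) = ⊤ → ∀ h : E →ᵃ[ℝ] ℝ, (∀ b ∈ τ, h b = ω b) →
      ∀ a ∈ S, a ∉ τ → h a ≠ ω a := by
  classical
  let K : Finset E × E → Subspace ℝ (E → ℝ) := fun q =>
    { carrier := {ω | ∃ h : E →ᵃ[ℝ] ℝ, (∀ b ∈ q.1, h b = ω b) ∧ h q.2 = ω q.2}
      zero_mem' := ⟨0, by simp⟩
      add_mem' := by
        rintro _ _ ⟨h, h1, h2⟩ ⟨k, k1, k2⟩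
        exact ⟨h + k, fun b hb => by simp [h1 b hb, k1 b hb], by simp [h2, k2]⟩
      smul_mem' := by
        rintro c _ ⟨h, h1, h2⟩
        exact ⟨c • h, fun b hb => by simp [h1 b hb], by simp [h2]⟩ }
  let I : Finset (Finset E × E) := (S.powerset ×ˢ S).filter fun q =>
    affineSpan ℝ (q.1 : Set E) = ⊤ ∧ q.2 ∉ q.1
  have htop : ⊤ ∉ I.image K := by
    intro hmem
    obtain ⟨⟨τ, a⟩, hq, hK⟩ := Finset.mem_image.1 hmem
    obtain ⟨-, hspan, ha⟩ := Finset.mem_filter.1 hq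
    have hδ : (Pi.single a 1 : E → ℝ) ∈ K (τ, a) := by rw [hK]; trivial
    obtain ⟨h, h1, h2⟩ := hδ
    have : h = 0 := by
      refine AffineMap.ext_on hspan fun b hb => ?_
      rw [h1 b hb, Pi.single_apply, if_neg]
      · rfl
      · rintro rfl; exact ha hb
    simp [this] at h2
  have hne := Subspace.biUnion_ne_univ_of_top_notMem htop
  obtain ⟨ω, hω⟩ := (Set.ne_univ_iff_exists_notMem _).1 hne
  refine ⟨ω, fun τ hτ hspan h hh a ha haτ heq => hω ?_⟩
  refine Set.mem_biUnion (x := K (τ, a)) (Finset.mem_coe.2 (Finset.mem_image.2 ⟨(τ, a), ?_, rfl⟩))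
    ⟨h, hh, heq⟩
  exact Finset.mem_filter.2 ⟨Finset.mem_product.2 ⟨Finset.mem_powerset.2 hτ, ha⟩, hspan, haτ⟩

theorem exists_pos_forall_add_mul_nonneg {α : Type*} (S : Finset α) (w c : α → ℝ)
    (hw : ∀ a ∈ S, 0 ≤ w a) (hc : ∀ a ∈ S, w a = 0 → 0 ≤ c a) :
    ∃ t : ℝ, 0 < t ∧ ∀ a ∈ S, 0 ≤ w a + t * c a := by
  have h : ∀ᶠ t in nhdsWithin (0 : ℝ) (Set.Ioi 0), 0 < t ∧ ∀ a ∈ S, 0 ≤ w a + t * c a := by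
    refine Filter.Eventually.and self_mem_nhdsWithin ((Filter.eventually_all_finset S).2 ?_)
    intro a ha
    rcases (hw a ha).eq_or_lt with h0 | h0
    · filter_upwards [self_mem_nhdsWithin] with t ht
      rw [← h0, zero_add]
      exact mul_nonneg (le_of_lt ht) (hc a ha h0.symm)
    · have : Filter.Tendsto (fun t : ℝ => w a + t * c a) (nhds 0) (nhds (w a + 0 * c a)) :=
        Continuous.tendsto (by fun_prop) 0
      rw [zero_mul, add_zero] at this
      exact ((this.eventually (lt_mem_nhds h0)).filter_mono nhdsWithin_le_nhds).mono
        fun t ht => ht.le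
  exact h.exists

/-- Weights on `S` that represent `x` as a convex combination. -/
def IsConvexWeight (S : Finset E) (x : E) (w : E → ℝ) : Prop :=
  (∀ a ∈ S, 0 ≤ w a) ∧ ∑ a ∈ S, w a = 1 ∧ ∑ a ∈ S, w a • a = x

theorem IsConvexWeight.sum_mul_nonneg {S : Finset E} {x : E} {w ω c : E → ℝ}
    (hw : IsConvexWeight S x w)
    (hmin : ∀ u, IsConvexWeight S x u → ∑ a ∈ S, w a * ω a ≤ ∑ a ∈ S, u a * ω a)
    (hc : ∀ a ∈ S, w a = 0 → 0 ≤ c a) (hc0 : ∑ a ∈ S, c a = 0) (hcx : ∑ a ∈ S, c a • a = 0) :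
    0 ≤ ∑ a ∈ S, c a * ω a := by
  obtain ⟨t, ht, hpos⟩ := exists_pos_forall_add_mul_nonneg S w c hw.1 hc
  have := hmin (fun a => w a + t * c a) ⟨hpos, ?_, ?_⟩
  · simp only [add_mul, Finset.sum_add_distrib, mul_assoc, ← Finset.mul_sum] at this
    exact nonneg_of_mul_nonneg_right (by linarith) ht
  · rw [Finset.sum_add_distrib, ← Finset.mul_sum, hc0, hw.2.1, mul_zero, add_zero]
  · simp only [add_smul, Finset.sum_add_distrib, mul_smul, ← Finset.smul_sum, hcx, hw.2.2,
      smul_zero, add_zero]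

end RegularTriangulation

section Triangulation

variable {E : Type*} [NormedAddCommGroup E] [NormedSpace ℝ E]

theorem exists_isConvexWeight_minimal (S : Finset E) (ω : E → ℝ) {x : E}
    (hx : x ∈ convexHull ℝ (S : Set E)) : ∃ w, IsConvexWeight S x w ∧
      ∀ u, IsConvexWeight S x u → ∑ a ∈ S, w a * ω a ≤ ∑ a ∈ S, u a * ω a := by
  classical
  let K : Set (S → ℝ) := stdSimplex ℝ S ∩ {w | ∑ a, w a • (a : E) = x}
  have hK : IsCompact K := (isCompact_stdSimplex ℝ S).inter_right
    (isClosed_eq (f := fun w : S → ℝ => ∑ a, w a • (a : E)) (by fun_prop) continuous_const)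
  have hmem : ∀ u, IsConvexWeight S x u → (fun a : S => u a) ∈ K := fun u hu =>
    ⟨⟨fun a => hu.1 a a.2, (Finset.sum_coe_sort S u).trans hu.2.1⟩,
      (Finset.sum_coe_sort S fun a => u a • a).trans hu.2.2⟩
  obtain ⟨u₀, hu₀⟩ := Finset.mem_convexHull'.1 hx
  obtain ⟨w, hw, hmin⟩ := hK.exists_isMinOn ⟨_, hmem u₀ hu₀⟩
    (f := fun w : S → ℝ => ∑ a, w a * ω a) (by fun_prop)
  let w' : E → ℝ := fun a => if h : a ∈ S then w ⟨a, h⟩ else 0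
  have hw' : ∀ a : S, w' a = w a := fun a => by simp [w']
  refine ⟨w', ⟨fun a ha => ?_, ?_, ?_⟩, fun u hu => ?_⟩
  · exact (hw.1.1 ⟨a, ha⟩).trans_eq (hw' ⟨a, ha⟩).symm
  · rw [← Finset.sum_coe_sort]
    simpa only [hw'] using hw.1.2
  · rw [← Finset.sum_coe_sort]
    simpa only [hw'] using Set.mem_ofPred.1 hw.2
  · rw [← Finset.sum_coe_sort, ← Finset.sum_coe_sort S]
    simpa only [hw'] using isMinOn_iff.1 hmin _ (hmem u hu)

theorem exists_isRegularCell_mem_convexHull {S : Finset E} {ω : E → ℝ}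
    (hω : ∀ τ ⊆ S, affineSpan ℝ (τ : Set E) = ⊤ → ∀ h : E →ᵃ[ℝ] ℝ, (∀ b ∈ τ, h b = ω b) →
      ∀ a ∈ S, a ∉ τ → h a ≠ ω a) {x : E} (hx : x ∈ convexHull ℝ (S : Set E))
    (hgen : ∀ τ ⊆ S, x ∈ affineSpan ℝ (τ : Set E) → affineSpan ℝ (τ : Set E) = ⊤) :
    ∃ σ ⊆ S, σ.card = Module.finrank ℝ E + 1 ∧ IsRegularCell ω S σ ∧
      x ∈ convexHull ℝ (σ : Set E) := by
  classical
  obtain ⟨w, hw, hmin⟩ := exists_isConvexWeight_minimal S ω hx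
  set τ := S.filter fun a => w a ≠ 0 with hτ
  have hτS : τ ⊆ S := Finset.filter_subset _ _
  have hxτ : x ∈ convexHull ℝ (τ : Set E) := by
    refine Finset.mem_convexHull'.2 ⟨w, fun a ha => hw.1 a (hτS ha), ?_, ?_⟩
    · rw [hτ, Finset.sum_filter_ne_zero, hw.2.1]
    · rw [← hw.2.2]
      refine Finset.sum_subset hτS fun a ha hn => ?_
      have : w a = 0 := by simpa [hτ, ha] using hn
      rw [this, zero_smul]
  have hspan := hgen τ hτS (convexHull_subset_affineSpan _ hxτ)
  obtain ⟨s, hs, b, hb⟩ := AffineBasis.exists_affine_subbasis hspan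
  have hfin : s.Finite := τ.finite_toSet.subset hs
  obtain ⟨σ, rfl⟩ := hfin.exists_finset_coe
  have hστ : σ ⊆ τ := Finset.coe_subset.1 hs
  have hσspan : affineSpan ℝ (σ : Set E) = ⊤ := by
    have := b.tot
    rwa [hb, Subtype.range_coe] at this
  let h : E →ᵃ[ℝ] ℝ := 
    (∑ i : (σ : Set E), ω i • LinearMap.proj i : (↥(σ : Set E) → ℝ) →ₗ[ℝ] ℝ).toAffineMap.comp b.coords
  have hh : ∀ a ∈ σ, h a = ω a := fun a ha => by
    have hba : b ⟨a, ha⟩ = a := by rw [hb]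
    have hc : ∀ i, b.coord i a = if i = ⟨a, ha⟩ then 1 else 0 := fun i => by
      conv_lhs => rw [← hba, b.coord_apply]
    have : h a = ∑ i : (σ : Set E), ω i * b.coord i a := by
      simp [h]
    rw [this]
    simp [hc]
  have hdiff : ∀ a ∈ S, ∃ c : E → ℝ, (∀ e, e ≠ a → e ∉ σ → c e = 0) ∧ (a ∉ σ → c a = 1) ∧
      ∑ e ∈ S, c e = 0 ∧ ∑ e ∈ S, c e • e = 0 ∧ ∑ e ∈ S, c e * ω e = ω a - h a := by
    intro a ha
    obtain ⟨g, hg0, hg1, hga⟩ := exists_weights_of_mem_affineSpan (σ := σ) (a := a)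
      (by rw [hσspan]; trivial)
    have hS : ∀ (f : E → ℝ), ∑ e ∈ S, g e * f e = ∑ e ∈ σ, g e * f e := fun f =>
      (Finset.sum_subset (hστ.trans hτS) fun e _ he => by rw [hg0 e he, zero_mul]).symm
    refine ⟨fun e => (if e = a then 1 else 0) - g e, fun e hea he => by simp [hea, hg0 e he],
      fun haσ => by simp [hg0 a haσ], ?_, ?_, ?_⟩
    · have := hS (fun _ => (1 : ℝ))
      simp only [mul_one] at this
      simp [Finset.sum_sub_distrib, ha, this, hg1]
    · simp only [sub_smul, Finset.sum_sub_distrib, ite_smul, one_smul, zero_smul,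
        Finset.sum_ite_eq', ha, if_true]
      rw [← Finset.sum_subset (hστ.trans hτS) fun e _ he => by rw [hg0 e he, zero_smul], hga,
        sub_self]
    · simp only [sub_mul, Finset.sum_sub_distrib, ite_mul, one_mul, zero_mul,
        Finset.sum_ite_eq', ha, if_true]
      rw [hS ω, ← hga, affineMap_apply_sum_smul _ _ _ hg1]
      congr 1
      exact Finset.sum_congr rfl fun e he => by rw [hh e he]
  have hle : ∀ a ∈ S, a ∉ σ → h a ≤ ω a := fun a ha haσ => by
    obtain ⟨c, hc, hca, hc0, hcx, hcω⟩ := hdiff a ha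
    refine sub_nonneg.1 (hcω ▸ hw.sum_mul_nonneg hmin (fun e he hwe => ?_) hc0 hcx)
    by_cases hea : e = a
    · rw [hea, hca haσ]; exact zero_le_one
    · refine (hc e hea fun h' => ?_).ge
      exact (Finset.mem_filter.1 (hστ h')).2 hwe
  have hge : ∀ a ∈ τ, a ∉ σ → ω a ≤ h a := fun a ha haσ => by
    obtain ⟨c, hc, hca, hc0, hcx, hcω⟩ := hdiff a (hτS ha)
    have := hw.sum_mul_nonneg (c := fun e => - c e) hmin (fun e he hwe => ?_) (by simp [hc0])
      (by simp [hcx])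
    · simp only [neg_mul, Finset.sum_neg_distrib, hcω] at this
      linarith
    · rw [hc e _ _, neg_zero]
      · rintro rfl; exact (Finset.mem_filter.1 ha).2 hwe
      · exact fun h' => (Finset.mem_filter.1 (hστ h')).2 hwe
  have hne := hω σ (hστ.trans hτS) hσspan h hh
  have hτσ : τ = σ := Finset.Subset.antisymm (fun a ha => by
    by_contra haσ
    exact hne a (hτS ha) haσ (le_antisymm (hle a (hτS ha) haσ) (hge a ha haσ))) hστ
  refine ⟨σ, hστ.trans hτS, ?_, ⟨h, hh, fun a ha haσ => (hle a ha haσ).lt_of_ne (hne a ha haσ)⟩,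
    hτσ ▸ hxτ⟩
  have := b.card_eq_finrank_add_one
  simpa using this

variable [FiniteDimensional ℝ E] [MeasurableSpace E] [BorelSpace E]

/-- The regular triangulation defined by generic heights computes the measure of the convex hull of
a finite set. -/
theorem exists_measure_convexHull_eq_sum (μ : Measure E) [μ.IsAddHaarMeasure] (S : Finset E) :
    ∃ T ⊆ S.powersetCard (Module.finrank ℝ E + 1),
      μ (convexHull ℝ (S : Set E)) = ∑ σ ∈ T, μ (convexHull ℝ (σ : Set E)) := by
  classical
  obtain ⟨ω, hω⟩ := exists_generic_heights S
  let T := (S.powersetCard (Module.finrank ℝ E + 1)).filter (IsRegularCell ω S)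
  have hT : ∀ σ ∈ T, σ ⊆ S ∧ σ.card = Module.finrank ℝ E + 1 ∧ IsRegularCell ω S σ := fun σ hσ => by
    obtain ⟨h1, h2⟩ := Finset.mem_filter.1 hσ
    obtain ⟨h3, h4⟩ := Finset.mem_powersetCard.1 h1
    exact ⟨h3, h4, h2⟩
  refine ⟨T, Finset.filter_subset _ _, ?_⟩
  rw [← measure_biUnion_finset₀]
  · have hnull : μ (⋃ τ ∈ S.powerset.filter fun τ : Finset E => affineSpan ℝ (τ : Set E) ≠ ⊤,
        (affineSpan ℝ (τ : Set E) : Set E)) = 0 := by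
      refine (measure_biUnion_null_iff (Finset.countable_toSet _)).2 fun τ hτ =>
        Measure.addHaar_affineSubspace μ _ (Finset.mem_filter.1 hτ).2
    refine le_antisymm ?_ (measure_mono (Set.iUnion₂_subset fun σ hσ =>
      convexHull_mono (Finset.coe_subset.2 (hT σ hσ).1)))
    rw [← measure_sdiff_null (s := convexHull ℝ (S : Set E)) hnull]
    refine measure_mono fun x hx => ?_
    obtain ⟨σ, h1, h2, h3, h4⟩ := exists_isRegularCell_mem_convexHull hω hx.1 (fun τ hτ hxτ => by
      by_contra hn
      exact hx.2 (Set.mem_biUnion (Finset.mem_coe.2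
        (Finset.mem_filter.2 ⟨Finset.mem_powerset.2 hτ, hn⟩)) hxτ))
    exact Set.mem_biUnion (Finset.mem_coe.2 (Finset.mem_filter.2
      ⟨Finset.mem_powersetCard.2 ⟨h1, h2⟩, h3⟩)) h4
  · intro σ hσ τ hτ hne
    obtain ⟨h1, h2, h3⟩ := hT σ hσ
    obtain ⟨k1, k2, k3⟩ := hT τ hτ
    refine measure_mono_null (t := (affineSpan ℝ ((σ ∩ τ : Finset E) : Set E) : Set E))
      (fun x hx => convexHull_subset_affineSpan _ (h3.mem_convexHull_inter k3 h1 k1 hx.1 hx.2))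
      (Measure.addHaar_affineSubspace μ _ fun htop => ?_)
    have hcard : (σ ∩ τ).card < Module.finrank ℝ E + 1 := by
      rw [← h2]
      refine Finset.card_lt_card (Finset.ssubset_iff_subset_ne.2 ⟨Finset.inter_subset_left, ?_⟩)
      intro heq
      exact hne (Finset.eq_of_subset_of_card_le (Finset.inter_eq_left.1 heq) (by rw [h2, k2]))
    obtain ⟨s, hs, b, hb⟩ := AffineBasis.exists_affine_subbasis htop
    obtain ⟨ρ, rfl⟩ := ((σ ∩ τ).finite_toSet.subset hs).exists_finset_coe
    have hc := b.card_eq_finrank_add_one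
    have hle := Finset.card_le_card (Finset.coe_subset.1 hs)
    simp only [Finset.coe_sort_coe, Fintype.card_coe] at hc
    omega
  · intro σ hσ
    exact (σ.finite_toSet.isCompact_convexHull ℝ).measurableSet.nullMeasurableSet

end Triangulation

/-- A lattice simplex with vertices in `P` has normalized volume divisible by the index of `P`. -/
theorem exists_normalizedVolume_convexHull_finset_eq {d : ℕ} {P : Set (Fin d → ℝ)}
    {σ : Finset (Fin d → ℝ)} (hσ : ∀ x ∈ σ, ∃ z ∈ latticePoints P, latticeEmb d z = x)
    (hcard : σ.card = d + 1) :
    ∃ n : ℕ, normalizedVolume (convexHull ℝ (σ : Set (Fin d → ℝ))) = index P * n := by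
  let e := (σ.equivFinOfCardEq hcard).symm
  choose z hz hze using fun i => hσ (e i) (e i).2
  obtain ⟨n, hn⟩ := exists_normalizedVolume_convexHull_range_eq
    (affineLattice P).direction.toAddSubgroup z fun i =>
      AffineSubspace.vsub_mem_direction (subset_affineSpan ℤ _ (hz i)) (subset_affineSpan ℤ _ (hz 0))
  refine ⟨n, ?_⟩
  rw [index, ← hn]
  congr 2
  simp only [hze]
  rw [← Function.comp_def, e.surjective.range_comp, Subtype.range_coe]

theorem exists_normalizedVolume_eq_index_mul {d : ℕ} {P : Set (Fin d → ℝ)}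
    {V : Finset (Fin d → ℝ)} (hV : ∀ x ∈ V, ∃ z ∈ latticePoints P, latticeEmb d z = x) :
    ∃ n : ℕ, normalizedVolume (convexHull ℝ (V : Set (Fin d → ℝ))) = index P * n := by
  obtain ⟨T, hT, hvol⟩ := exists_measure_convexHull_eq_sum volume V
  rw [Module.finrank_fin_fun] at hT
  have hcell : ∀ σ ∈ T, ∃ n : ℕ,
      normalizedVolume (convexHull ℝ (σ : Set (Fin d → ℝ))) = index P * n := fun σ hσ => by
    obtain ⟨h1, h2⟩ := Finset.mem_powersetCard.1 (hT hσ)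
    exact exists_normalizedVolume_convexHull_finset_eq (fun x hx => hV x (h1 hx)) h2
  choose! n hn using hcell
  refine ⟨∑ σ ∈ T, n σ, ?_⟩
  rw [normalizedVolume, hvol, ENNReal.toReal_sum fun σ _ =>
    (σ.finite_toSet.isCompact_convexHull ℝ).measure_lt_top.ne, Finset.mul_sum, Nat.cast_sum,
    Finset.mul_sum]
  exact Finset.sum_congr rfl hn

/-- A closed subset of full measure in a convex set with nonempty interior contains it. -/
theorem subset_of_measure_le {E : Type*} [NormedAddCommGroup E] [NormedSpace ℝ E]
    [MeasurableSpace E] [BorelSpace E] {μ : Measure E} [μ.IsOpenPosMeasure] {C P : Set E}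
    (hP : Convex ℝ P) (hint : (interior P).Nonempty) (hC : IsClosed C) (hCP : C ⊆ P)
    (hfin : μ C ≠ ⊤) (hle : μ P ≤ μ C) : P ⊆ C := by
  have h0 : μ (P \ C) = 0 := by
    rw [measure_sdiff hCP hC.measurableSet.nullMeasurableSet hfin]
    exact tsub_eq_zero_of_le hle
  have hempty : interior P \ C = ∅ :=
    (isOpen_interior.sdiff hC).eq_empty_of_measure_zero
      (measure_mono_null (Set.sdiff_subset_sdiff_left interior_subset) h0)
  calc P ⊆ closure P := subset_closure
    _ = closure (interior P) := (hP.closure_interior_eq_closure_of_nonempty_interior hint).symm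
    _ ⊆ C := closure_minimal (Set.sdiff_eq_empty.1 hempty) hC

theorem IsConvexPolytope.isCompact {d : ℕ} {P : Set (Fin d → ℝ)} (hP : IsConvexPolytope P) :
    IsCompact P := by
  obtain ⟨S, hS, rfl⟩ := hP
  exact hS.isCompact_convexHull ℝ

theorem IsConvexPolytope.convex {d : ℕ} {P : Set (Fin d → ℝ)} (hP : IsConvexPolytope P) :
    Convex ℝ P := by
  obtain ⟨S, hS, rfl⟩ := hP
  exact convex_convexHull ℝ S

/-- A convex polytope is the convex hull of its finitely many vertices. -/
theorem IsConvexPolytope.exists_finset_extremePoints {d : ℕ} {P : Set (Fin d → ℝ)}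
    (hP : IsConvexPolytope P) : ∃ V : Finset (Fin d → ℝ),
      (V : Set (Fin d → ℝ)) = P.extremePoints ℝ ∧ P = convexHull ℝ (V : Set (Fin d → ℝ)) := by
  have hfin : (P.extremePoints ℝ).Finite := by
    obtain ⟨S, hS, rfl⟩ := hP
    exact hS.subset extremePoints_convexHull_subset
  obtain ⟨V, hV⟩ := hfin.exists_finset_coe
  refine ⟨V, hV, ?_⟩
  rw [← (V.finite_toSet.isClosed_convexHull ℝ).closure_eq, hV,
    closure_convexHull_extremePoints hP.isCompact hP.convex]

theorem affineSpan_insert_erase_eq_top {E : Type*} [AddCommGroup E] [Module ℝ E] [DecidableEq E]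
    {σ : Finset E} (hσ : affineSpan ℝ (σ : Set E) = ⊤) {w : E → ℝ} {b : E} (hb : b ∈ σ)
    (hwb : w b ≠ 0) (hw : ∑ e ∈ σ, w e = 1) :
    affineSpan ℝ ((insert (∑ e ∈ σ, w e • e) (σ.erase b) : Finset E) : Set E) = ⊤ := by
  set a := ∑ e ∈ σ, w e • e with ha
  set H := affineSpan ℝ ((insert a (σ.erase b) : Finset E) : Set E) with hH
  have hσ0 : ∀ e ∈ σ, e ≠ b → e ∈ H := fun e he hne =>
    subset_affineSpan ℝ _ (by simp [he, hne])
  have haH : a ∈ H := subset_affineSpan ℝ _ (by simp)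
  have hbH : b ∈ H := by
    have hdir : ∑ e ∈ σ.erase b, w e • (e - a) ∈ H.direction := sum_mem fun e he =>
      H.direction.smul_mem _ (AffineSubspace.vsub_mem_direction
        (hσ0 e (Finset.mem_of_mem_erase he) (Finset.ne_of_mem_erase he)) haH)
    have hsum : w b • (b - a) + ∑ e ∈ σ.erase b, w e • (e - a) = 0 := by
      rw [Finset.add_sum_erase σ (fun e => w e • (e - a)) hb]
      simp only [smul_sub, Finset.sum_sub_distrib, ← Finset.sum_smul, hw, one_smul, ← ha, sub_self]
    have hba : w b • (b - a) ∈ H.direction := by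
      rw [eq_neg_of_add_eq_zero_left hsum]
      exact neg_mem hdir
    have := AffineSubspace.vadd_mem_of_mem_direction
      ((H.direction.smul_mem_iff hwb).1 hba) haH
    simpa using this
  rw [eq_top_iff, ← hσ, affineSpan_le]
  intro e he
  by_cases h : e = b
  exacts [h ▸ hbH, hσ0 e he h]

theorem normalizedVolume_convexHull_pos {d : ℕ} {σ : Finset (Fin d → ℝ)}
    (hσ : affineSpan ℝ (σ : Set (Fin d → ℝ)) = ⊤) :
    0 < normalizedVolume (convexHull ℝ (σ : Set (Fin d → ℝ))) := by
  refine mul_pos (by positivity) (ENNReal.toReal_pos ?_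
    (σ.finite_toSet.isCompact_convexHull ℝ).measure_lt_top.ne)
  exact (Measure.measure_pos_of_nonempty_interior _
    (interior_convexHull_nonempty_iff_affineSpan_eq_top.2 hσ)).ne'

/-- A full-dimensional lattice polytope whose normalized volume equals its index is an empty
simplex. -/
theorem isEmptySimplex_of_normalizedVolume_eq_index {d : ℕ} {P : Set (Fin d → ℝ)}
    (hP : IsLatticePolytope P) (hdim : dim P = d) (hvol : normalizedVolume P = index P)
    (hpos : 0 < index P) : IsEmptySimplex P := by
  classical
  obtain ⟨V, hV, hPV⟩ := hP.1.exists_finset_extremePoints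
  have hPne : P.Nonempty := by
    by_contra h
    rw [Set.not_nonempty_iff_eq_empty] at h
    rw [h] at hvol
    simp only [normalizedVolume, measure_empty, ENNReal.toReal_zero, mul_zero] at hvol
    rw [h] at hpos
    exact hpos.ne (by exact_mod_cast hvol)
  have hspan : affineSpan ℝ (V : Set (Fin d → ℝ)) = ⊤ := by
    rw [← affineSpan_convexHull, ← hPV,
      AffineSubspace.affineSpan_eq_top_iff_vectorSpan_eq_top_of_nonempty ℝ _ _ hPne]
    exact Submodule.eq_top_of_finrank_eq (by rw [Module.finrank_fin_fun]; exact hdim)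
  have hint : (interior P).Nonempty := by
    rw [hPV]; exact interior_convexHull_nonempty_iff_affineSpan_eq_top.2 hspan
  have hfull : ∀ σ : Finset (Fin d → ℝ), (∀ x ∈ σ, ∃ z ∈ latticePoints P, latticeEmb d z = x) →
      σ.card = d + 1 → affineSpan ℝ (σ : Set (Fin d → ℝ)) = ⊤ →
      P = convexHull ℝ (σ : Set (Fin d → ℝ)) := by
    intro σ hσ hcard hσspan
    have hsub : convexHull ℝ (σ : Set (Fin d → ℝ)) ⊆ P := by
      refine convexHull_min (fun x hx => ?_) hP.1.convex
      obtain ⟨z, hz, rfl⟩ := hσ x hx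
      exact hz
    have hcpt := σ.finite_toSet.isCompact_convexHull (𝕜 := ℝ)
    refine subset_antisymm (subset_of_measure_le (μ := volume) hP.1.convex hint hcpt.isClosed hsub
      hcpt.measure_lt_top.ne ?_) hsub
    obtain ⟨n, hn⟩ := exists_normalizedVolume_convexHull_finset_eq hσ hcard
    have hnpos := normalizedVolume_convexHull_pos hσspan
    have hn1 : (1 : ℝ) ≤ n := by
      rw [hn] at hnpos
      have : 0 < n := by
        rcases Nat.eq_zero_or_pos n with h | h
        · simp [h] at hnpos
        · exact h
      exact_mod_cast this
    have hle : normalizedVolume P ≤ normalizedVolume (convexHull ℝ (σ : Set (Fin d → ℝ))) := by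
      rw [hn, hvol]
      exact le_mul_of_one_le_right (Nat.cast_nonneg _) hn1
    rw [← ENNReal.toReal_le_toReal hP.1.isCompact.measure_lt_top.ne hcpt.measure_lt_top.ne]
    exact le_of_mul_le_mul_left hle (by positivity)
  obtain ⟨s, hs, b, hb⟩ := AffineBasis.exists_affine_subbasis hspan
  obtain ⟨σ, rfl⟩ := (V.finite_toSet.subset hs).exists_finset_coe
  have hcard : σ.card = d + 1 := by simpa using b.card_eq_finrank_add_one
  have hσspan : affineSpan ℝ (σ : Set (Fin d → ℝ)) = ⊤ := by
    have := b.tot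
    rwa [hb, Subtype.range_coe] at this
  have hσext : ∀ x ∈ σ, x ∈ P.extremePoints ℝ := fun x hx => hV ▸ hs hx
  have hσlat : ∀ x ∈ σ, ∃ z ∈ latticePoints P, latticeEmb d z = x := fun x hx => by
    obtain ⟨z, rfl⟩ := hP.2 (hσext x hx)
    exact ⟨z, (hσext _ hx).1, rfl⟩
  have hPσ := hfull σ hσlat hcard hσspan
  let e := (σ.equivFinOfCardEq hcard).symm
  have hrange : Set.range (fun i => (e i : Fin d → ℝ)) = σ := by
    rw [← Function.comp_def, e.surjective.range_comp, Subtype.range_coe]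
  refine ⟨hP, d, ⟨fun i => e i, ?_⟩, ?_, fun z hz => ?_⟩
  · have := b.ind.comp_embedding e.toEmbedding
    rwa [hb] at this
  · simp only [hrange]; exact hPσ
  · simp only [hrange]
    by_contra hzσ
    have hz' : latticeEmb d z ∈ convexHull ℝ (σ : Set (Fin d → ℝ)) := hPσ ▸ hz
    obtain ⟨w, hw0, hw1, hwz⟩ := Finset.mem_convexHull'.1 hz'
    obtain ⟨x, hx, hwx⟩ := Finset.exists_ne_zero_of_sum_ne_zero (hw1.trans_ne one_ne_zero)
    have hspan' := affineSpan_insert_erase_eq_top hσspan hx hwx hw1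
    rw [hwz] at hspan'
    have hP' := hfull _ (fun y hy => by
      rcases Finset.mem_insert.1 hy with rfl | hy
      · exact ⟨z, hz, rfl⟩
      · exact hσlat y (Finset.mem_of_mem_erase hy)) (by
      rw [Finset.card_insert_of_notMem fun h => hzσ (Finset.mem_of_mem_erase h),
        Finset.card_erase_of_mem hx, hcard, Nat.add_sub_cancel]) hspan'
    have hxext := hσext x hx
    rw [hP'] at hxext
    have hmem := extremePoints_convexHull_subset hxext
    rcases Finset.mem_insert.1 (Finset.mem_coe.1 hmem) with h | h
    · exact hzσ (h ▸ hx)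
    · exact Finset.ne_of_mem_erase h rfl

end LatticePolytope

theorem mainTheorem2 (p : ℕ) (hp : p.Prime) (d : ℕ) (P : Set (Fin d → ℝ))
    (hP : LatticePolytope.IsLatticePolytope P)
    (hdim : LatticePolytope.dim P = d)
    (hvol : LatticePolytope.normalizedVolume P = (p : ℝ))
    (hne : ¬ LatticePolytope.IsEmptySimplex P) :
    LatticePolytope.IsSpanning P := by
  obtain ⟨V, hV, hPV⟩ := hP.1.exists_finset_extremePoints
  obtain ⟨n, hn⟩ := LatticePolytope.exists_normalizedVolume_eq_index_mul (P := P) (V := V)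
    fun x hx => by
      have hx' : x ∈ P.extremePoints ℝ := hV ▸ hx
      obtain ⟨z, rfl⟩ := hP.2 hx'
      exact ⟨z, hx'.1, rfl⟩
  rw [← hPV, hvol] at hn
  have hdvd : LatticePolytope.index P ∣ p := ⟨n, by exact_mod_cast hn⟩
  rcases (Nat.dvd_prime hp).1 hdvd with h | h
  · exact h
  · exact absurd (LatticePolytope.isEmptySimplex_of_normalizedVolume_eq_index hP hdim
      (by rw [hvol, h]) (h ▸ hp.pos)) hne
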